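/- Let $R$ be a rational function over $\mathbb{C}$ of degree $\deg(R)\ge 2$ (the maximum of the degrees of numerator and denominator in lowest terms), and let $f(z)=R(z)-\overline{z}$. A zero of $f$ is a point $z\in\mathbb{C}$ that is not a pole of $R$ and satisfies $R(z)=\overline z$; it is called sense-preserving if $|R'(z)|>1$, sense-reversing if $|R'(z)|<1$, and singular if $|R'(z)|=1$. The function $f$ is called regular if none of its zeros is singular. The same terms are used for $F(z)=f(z)+\frac{\varepsilon}{z-z_0}$, with analytic part $R(z)+\frac{\varepsilon}{z-z_0}$. Zeros are counted as distinct points, and $D(z_0,r)$ is the open disk of radius $r$ around $z_0$. **Theorem.** Let $f(z)=R(z)-\overline z$ with $\deg(R)\ge 2$ be regular and satisfy $\lim_{z\to\infty}f(z)=\infty$, and let $z_0\in\mathbb{C}$. 1. If $z_0$ is a pole of $f$, then for all sufficiently small $\varepsilon>0$ for which $F(z)=f(z)+\frac{\varepsilon}{z-z_0}$ is regular, $F$ and $f$ have the same (finite) number of zeros. In each of the following cases there exists $r_0>0$ such that for every $r\in(0,r_0]$ the stated conclusion holds for all sufficiently small $\varepsilon>0$ (depending on $r$) for which $F$ is regular.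 2. If $0<|f(z_0)|<\infty$: $0<|f(z)|<\infty$ for all $z\in D(z_0,r)$, and $F$ has at least one sense-preserving zero in $D(z_0,r)$. 3. If $f(z_0)=0$ and $|R'(z_0)|>1$: $F$ has at least two sense-preserving zeros in $D(z_0,r)$. 4. If $f(z_0)=0$ and $0<|R'(z_0)|<1$: $F$ has at least two sense-preserving zeros and at least two sense-reversing zeros in $D(z_0,r)$. Further, in cases 2, 3 and 4, for the same $r$ and $\varepsilon$, $F$ and $f$ have the same (finite) number of zeros in $\mathbb{C}\setminus D(z_0,r)$. -/

import Mathlib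

namespace RationalHarmonic

noncomputable section

/-- The degree of a rational function `R = p / q` in lowest terms: `max (deg p) (deg q)`. -/
def ratDegree (R : RatFunc ℂ) : ℕ := max R.num.natDegree R.denom.natDegree

/-- `z` is a pole of `R` (equivalently of `f(z) = R(z) - conj z`): the denominator of `R` in
lowest terms vanishes at `z`. -/
def IsPole (R : RatFunc ℂ) (z : ℂ) : Prop := R.denom.eval z = 0

/-- The value `R(z)`; meaningful when `z` is not a pole of `R`. -/
def ratEval (R : RatFunc ℂ) (z : ℂ) : ℂ := R.eval (RingHom.id ℂ) z

/-- The rational harmonic function `f(z) = R(z) - conj z`; meaningful when `z` is not a pole. -/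
def harm (R : RatFunc ℂ) (z : ℂ) : ℂ := ratEval R z - (starRingEnd ℂ) z

/-- The zeros of `f(z) = R(z) - conj z` in `ℂ` (poles are not zeros). -/
def zeros (R : RatFunc ℂ) : Set ℂ := {z | ¬ IsPole R z ∧ harm R z = 0}

/-- The sense-preserving zeros of `f(z) = R(z) - conj z`: zeros with `|R'(z)| > 1`. -/
def sensePreservingZeros (R : RatFunc ℂ) : Set ℂ :=
  {z | z ∈ zeros R ∧ 1 < ‖deriv (ratEval R) z‖}

/-- The sense-reversing zeros of `f(z) = R(z) - conj z`: zeros with `|R'(z)| < 1`. -/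
def senseReversingZeros (R : RatFunc ℂ) : Set ℂ :=
  {z | z ∈ zeros R ∧ ‖deriv (ratEval R) z‖ < 1}

/-- `f(z) = R(z) - conj z` is regular: no zero of `f` is singular, i.e. satisfies `|R'(z)| = 1`. -/
def IsRegular (R : RatFunc ℂ) : Prop :=
  ∀ z ∈ zeros R, ‖deriv (ratEval R) z‖ ≠ 1

/-- The rational function `R(z) + ε / (z - z₀)`, the analytic part of
`F(z) = f(z) + ε / (z - z₀)`. -/
def perturb (R : RatFunc ℂ) (z₀ : ℂ) (ε : ℝ) : RatFunc ℂ :=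
  R + RatFunc.C (ε : ℂ) / (RatFunc.X - RatFunc.C z₀)

/-- Two sets are finite and have the same number of elements. -/
def SameFiniteCard (A B : Set ℂ) : Prop := A.Finite ∧ B.Finite ∧ A.ncard = B.ncard

end

end RationalHarmonic

/-!
Everything follows from the implicit function theorem (`exists_zero_branch`) and compactness,
without a degree or argument principle.

Away from `z₀`, `F = f + ε / (z - z₀)` is a smooth small perturbation of `f`. At a zero `p` of `f`
the real differential is `ζ ↦ R'(p) ζ - conj ζ`, which is invertible exactly because
`|R'(p)| ≠ 1`, so `p` continues to a unique zero of `F` (`exists_zeros_perturb_branch`). Near any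
other point of `ℂ`, near the poles and near infinity `F` has no zeros for small `ε`; near a pole
`z₀` this holds because `ε` is too small to cancel the principal part
(`IsPole.eventually_notMem_zeros_perturb_self`). Compactness of `ℂ ∪ {∞}` turns these local
statements into equality of the numbers of zeros outside the disk
(`eventually_sameFiniteCard_zeros_diff_ball`); for a pole `z₀` the disk is taken empty.

The zeros near `z₀` are found by rescaling. If `f(z₀) ≠ 0`, put `z = z₀ + ε u`: the limit equation
is `f(z₀) + 1 / u = 0`, and its simple root yields a zero at which the derivative of the analytic
part is of size `1 / ε` (`eventually_one_le_encard_sensePreservingZeros`). If `f(z₀) = 0` and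
`a = R'(z₀) ≠ 0`, put `ε = s ^ 2` and `z = z₀ + s u`: the limit equation is
`a u - conj u + 1 / u = 0`, and the derivative of the analytic part tends to `a - 1 / u ^ 2`.
Since `a u ^ 2 = |u| ^ 2 - 1` is real, the roots are found explicitly
(`exists_root_limit_equation`): a pair `±u` with `|a - 1 / u ^ 2| = 2 |a| + 1` always, and, if
`|a| < 1`, a second pair with `|a - 1 / u ^ 2| = |2 |a| - 1| < 1`. All are nondegenerate, so each
persists for small `s` (`exists_rescaled_branch`).
-/

namespace RationalHarmonic

open Filter Topology
open scoped ComplexConjugate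

/-! ### Rational functions and the perturbation by a simple pole -/

theorem ratEval_eq (R : RatFunc ℂ) :
    ratEval R = fun z => R.num.eval z / R.denom.eval z := by
  ext z
  simp [ratEval, RatFunc.eval, Polynomial.eval₂_id]

theorem analyticAt_ratEval {R : RatFunc ℂ} {z : ℂ} (hz : ¬ IsPole R z) :
    AnalyticAt ℂ (ratEval R) z := by
  rw [ratEval_eq]
  have h (p : Polynomial ℂ) : AnalyticAt ℂ (fun z => p.eval z) z := by
    simpa using AnalyticAt.aeval_polynomial (analyticAt_id (𝕜 := ℂ) (z := z)) p
  exact (h _).div (h _) hz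

theorem isOpen_setOf_not_isPole (R : RatFunc ℂ) : IsOpen {z | ¬ IsPole R z} :=
  isOpen_ne_fun R.denom.continuous continuous_const

theorem contDiffAt_harm {R : RatFunc ℂ} {z : ℂ} (hz : ¬ IsPole R z) :
    ContDiffAt ℝ 1 (harm R) z :=
  ((analyticAt_ratEval hz).contDiffAt.restrict_scalars ℝ).sub
    Complex.conjCLE.contDiff.contDiffAt

theorem denom_simplePole_dvd (z₀ : ℂ) (ε : ℝ) :
    (RatFunc.C (ε : ℂ) / (RatFunc.X - RatFunc.C z₀)).denom ∣ Polynomial.X - Polynomial.C z₀ := by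
  have := RatFunc.denom_div_dvd (Polynomial.C (ε : ℂ)) (Polynomial.X - Polynomial.C z₀)
  simpa using this

theorem not_isPole_simplePole {z₀ z : ℂ} (ε : ℝ) (h : z ≠ z₀) :
    ¬ IsPole (RatFunc.C (ε : ℂ) / (RatFunc.X - RatFunc.C z₀)) z := by
  intro h0
  have := Polynomial.eval_eq_zero_of_dvd_of_eval_eq_zero (denom_simplePole_dvd z₀ ε) h0
  exact h (sub_eq_zero.mp (by simpa using this))

theorem ratEval_simplePole {z₀ z : ℂ} (ε : ℝ) (h : z ≠ z₀) :
    ratEval (RatFunc.C (ε : ℂ) / (RatFunc.X - RatFunc.C z₀)) z = ε / (z - z₀) := by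
  have hX : (RatFunc.X - RatFunc.C z₀ : RatFunc ℂ) ≠ 0 := by
    have : (algebraMap (Polynomial ℂ) (RatFunc ℂ)) (Polynomial.X - Polynomial.C z₀) ≠ 0 :=
      RatFunc.algebraMap_ne_zero (Polynomial.X_sub_C_ne_zero z₀)
    simpa using this
  have hd : (RatFunc.X - RatFunc.C z₀ : RatFunc ℂ) =
      algebraMap (Polynomial ℂ) (RatFunc ℂ) (Polynomial.X - Polynomial.C z₀) := by simp
  have hmul := RatFunc.eval_mul (f := RingHom.id ℂ) (a := z)
    (x := RatFunc.C (ε : ℂ) / (RatFunc.X - RatFunc.C z₀)) (y := RatFunc.X - RatFunc.C z₀)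
    (by simpa [IsPole, Polynomial.eval₂_id] using not_isPole_simplePole ε h)
    (by rw [hd, RatFunc.denom_algebraMap]; simp)
  rw [div_mul_cancel₀ _ hX, RatFunc.eval_C, hd, RatFunc.eval_algebraMap] at hmul
  have h2 : z - z₀ ≠ 0 := sub_ne_zero.mpr h
  rw [eq_div_iff h2, ratEval]
  simpa using hmul.symm

theorem not_isPole_perturb {R : RatFunc ℂ} {z₀ z : ℂ} (ε : ℝ) (h : z ≠ z₀) (hz : ¬ IsPole R z) :
    ¬ IsPole (perturb R z₀ ε) z := by
  intro h0
  have := Polynomial.eval_eq_zero_of_dvd_of_eval_eq_zero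
    (RatFunc.denom_add_dvd R (RatFunc.C (ε : ℂ) / (RatFunc.X - RatFunc.C z₀))) h0
  rw [Polynomial.eval_mul, mul_eq_zero] at this
  exact this.elim hz (not_isPole_simplePole ε h)

theorem perturb_perturb_neg (R : RatFunc ℂ) (z₀ : ℂ) (ε : ℝ) :
    perturb (perturb R z₀ ε) z₀ (-ε) = R := by
  rw [perturb, perturb, add_assoc, ← add_div]
  simp

theorem isPole_perturb_iff {R : RatFunc ℂ} {z₀ z : ℂ} {ε : ℝ} (h : z ≠ z₀) :
    IsPole (perturb R z₀ ε) z ↔ IsPole R z := by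
  refine ⟨fun h1 => by_contra fun h2 => not_isPole_perturb ε h h2 h1,
    fun h1 => by_contra fun h2 => not_isPole_perturb (-ε) h h2 ?_⟩
  rwa [perturb_perturb_neg]

theorem ratEval_perturb {R : RatFunc ℂ} {z₀ z : ℂ} (ε : ℝ) (h : z ≠ z₀) (hz : ¬ IsPole R z) :
    ratEval (perturb R z₀ ε) z = ratEval R z + ε / (z - z₀) := by
  rw [← ratEval_simplePole ε h]
  exact RatFunc.eval_add (f := RingHom.id ℂ) (a := z)
    (by simpa [IsPole, Polynomial.eval₂_id] using hz)
    (by simpa [IsPole, Polynomial.eval₂_id] using not_isPole_simplePole ε h)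

theorem mem_zeros_perturb_iff {R : RatFunc ℂ} {z₀ z : ℂ} {ε : ℝ} (h : z ≠ z₀) :
    z ∈ zeros (perturb R z₀ ε) ↔ ¬ IsPole R z ∧ harm R z + ε / (z - z₀) = 0 := by
  simp only [zeros, Set.mem_ofPred_eq, isPole_perturb_iff h, and_congr_right_iff]
  intro hz
  rw [harm, harm, ratEval_perturb ε h hz, add_sub_right_comm]

theorem deriv_ratEval_perturb {R : RatFunc ℂ} {z₀ z : ℂ} (ε : ℝ) (h : z ≠ z₀)
    (hz : ¬ IsPole R z) :
    deriv (ratEval (perturb R z₀ ε)) z = deriv (ratEval R) z - ε / (z - z₀) ^ 2 := by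
  have hev : ratEval (perturb R z₀ ε) =ᶠ[𝓝 z] fun w => ratEval R w + ε / (w - z₀) := by
    filter_upwards [(isOpen_setOf_not_isPole R).mem_nhds hz, isOpen_ne.mem_nhds h] with w hw hw'
    exact ratEval_perturb ε hw' hw
  rw [hev.deriv_eq]
  have h1 := (analyticAt_ratEval hz).differentiableAt.hasDerivAt
  have h2 : HasDerivAt (fun w : ℂ => (ε : ℂ) / (w - z₀)) (-ε / (z - z₀) ^ 2) z := by
    have := ((hasDerivAt_const z (ε : ℂ)).fun_div ((hasDerivAt_id z).sub_const z₀)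
      (sub_ne_zero.mpr h))
    simpa using this
  rw [(h1.fun_add h2).deriv]
  ring

/-! ### Behaviour near poles and near infinity -/

/-- At a pole of any order, `(z - p) R(z)` stays away from `0`: after cancelling one factor `z - p`
of the denominator, the numerator is still nonzero at `p`. -/
theorem IsPole.exists_le_norm_sub_mul {R : RatFunc ℂ} {p : ℂ} (hp : IsPole R p) :
    ∃ c : ℝ, 0 < c ∧ ∀ᶠ z in 𝓝[≠] p, c ≤ ‖(z - p) * ratEval R z‖ := by
  obtain ⟨Q, hQ⟩ := Polynomial.dvd_iff_isRoot.mpr (show R.denom.IsRoot p from hp)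
  have hnum : R.num.eval p ≠ 0 := by
    intro h
    obtain ⟨a, b, hab⟩ := RatFunc.isCoprime_num_denom R
    have := congrArg (Polynomial.eval p) hab
    simp [h, show R.denom.eval p = 0 from hp] at this
  have hc : 0 < ‖R.num.eval p‖ / 2 / (‖Q.eval p‖ + 1) := by positivity
  refine ⟨_, hc, ?_⟩
  have h1 : ∀ᶠ z in 𝓝[≠] p, ‖R.num.eval p‖ / 2 < ‖R.num.eval z‖ :=
    (R.num.continuous.norm.continuousAt.eventually_const_lt
      (half_lt_self (norm_pos_iff.mpr hnum))).filter_mono nhdsWithin_le_nhds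
  have h2 : ∀ᶠ z in 𝓝[≠] p, ‖Q.eval z‖ < ‖Q.eval p‖ + 1 :=
    (Q.continuous.norm.continuousAt.eventually_lt_const (lt_add_one _)).filter_mono
      nhdsWithin_le_nhds
  have h3 : ∀ᶠ z in 𝓝[≠] p, R.denom.eval z ≠ 0 := by
    have : {z | R.denom.eval z ≠ 0} ∈ 𝓝[≠] p := by
      have hf : {z | R.denom.IsRoot z}.Finite :=
        Polynomial.finite_setOfPred_isRoot R.denom_ne_zero
      have h4 : ({z | R.denom.IsRoot z} \ {p})ᶜ ∈ 𝓝 p :=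
        (hf.subset Set.sdiff_subset).isClosed.isOpen_compl.mem_nhds (by simp)
      filter_upwards [mem_nhdsWithin_of_mem_nhds h4, self_mem_nhdsWithin] with z hz hz'
      exact fun h => hz ⟨h, hz'⟩
    exact this
  filter_upwards [h1, h2, h3, self_mem_nhdsWithin] with z hz1 hz2 hz3 hz4
  have hz5 : z - p ≠ 0 := sub_ne_zero.mpr hz4
  have hQz : R.denom.eval z = (z - p) * Q.eval z := by rw [hQ]; simp
  have hQ0 : Q.eval z ≠ 0 := fun h => hz3 (by rw [hQz, h, mul_zero])
  have : (z - p) * ratEval R z = R.num.eval z / Q.eval z := by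
    rw [ratEval_eq]
    simp only [hQz]
    field_simp
  rw [this, norm_div]
  have : 0 < ‖Q.eval z‖ := norm_pos_iff.mpr hQ0
  gcongr

/-- If `F` had a zero near the pole `p ≠ z₀` of `R`, then `(z - p) R(z)` would equal
`(z - p) (conj z - ε / (z - z₀))`, which tends to `0`. -/
theorem IsPole.eventually_notMem_zeros_perturb {R : RatFunc ℂ} {z₀ p : ℂ} (hp : IsPole R p)
    (hne : p ≠ z₀) :
    ∀ᶠ x in 𝓝[>] (0 : ℝ) ×ˢ 𝓝 p, x.2 ∉ zeros (perturb R z₀ x.1) := by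
  obtain ⟨c, hc, hev⟩ := hp.exists_le_norm_sub_mul
  have hcont : ContinuousAt (fun x : ℝ × ℂ => ‖(x.2 - p) * (conj x.2 - x.1 / (x.2 - z₀))‖)
      (0, p) := by
    have h0 : (((0 : ℝ), p) : ℝ × ℂ).2 - z₀ ≠ 0 := sub_ne_zero.mpr hne
    have h1 : ContinuousAt (fun x : ℝ × ℂ => (x.1 : ℂ) / (x.2 - z₀)) (0, p) :=
      ContinuousAt.div (by fun_prop) (by fun_prop) h0
    have h2 : ContinuousAt (fun x : ℝ × ℂ => conj x.2) (0, p) := by fun_prop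
    exact ((by fun_prop : ContinuousAt (fun x : ℝ × ℂ => x.2 - p) (0, p)).mul (h2.sub h1)).norm
  have hsmall := hcont.eventually_lt_const (u := c) (by simpa using hc)
  rw [nhds_prod_eq] at hsmall
  have hsmall' := hsmall.filter_mono (prod_mono_left _ (nhdsWithin_le_nhds (s := Set.Ioi 0)))
  have hev' := (eventually_nhdsWithin_iff.mp hev).prod_inr (𝓝[>] (0 : ℝ))
  have hne' := (isOpen_ne.eventually_mem hne).prod_inr (𝓝[>] (0 : ℝ))
  filter_upwards [hsmall', hev', hne'] with x h1 h2 h3 hx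
  obtain ⟨hx1, hx2⟩ := (mem_zeros_perturb_iff h3).mp hx
  have hxp : x.2 ≠ p := fun h => hx1 (h ▸ hp)
  have h4 : ratEval R x.2 = conj x.2 - x.1 / (x.2 - z₀) := by
    rw [harm] at hx2
    linear_combination hx2
  have h5 := h2 hxp
  rw [h4] at h5
  linarith

/-- Near the pole `z₀` of `R`, adding `ε / (z - z₀)` with small `ε` changes `(z - z₀) R(z)` by the
small constant `ε`; in particular `z₀` remains a pole. -/
theorem IsPole.eventually_notMem_zeros_perturb_self {R : RatFunc ℂ} {z₀ : ℂ}
    (hp : IsPole R z₀) :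
    ∀ᶠ x in 𝓝[>] (0 : ℝ) ×ˢ 𝓝 z₀, x.2 ∉ zeros (perturb R z₀ x.1) := by
  obtain ⟨c, hc, hev⟩ := hp.exists_le_norm_sub_mul
  have hε : ∀ᶠ ε : ℝ in 𝓝[>] 0, 0 < ε ∧ ε < c / 2 := Ioo_mem_nhdsGT (by positivity)
  -- Off `z₀`, `(z - z₀) (R(z) + ε / (z - z₀)) = (z - z₀) R(z) + ε` has modulus at least `c / 2`.
  have key {ε : ℝ} (h : 0 < ε ∧ ε < c / 2) {z : ℂ} (hz : z ≠ z₀)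
      (h2 : c ≤ ‖(z - z₀) * ratEval R z‖) :
      c / 2 ≤ ‖(z - z₀) * (ratEval R z + ε / (z - z₀))‖ := by
    have hz' : z - z₀ ≠ 0 := sub_ne_zero.mpr hz
    have e : (z - z₀) * (ratEval R z + ε / (z - z₀)) = (z - z₀) * ratEval R z + ε := by
      field_simp
    have h3 := norm_sub_le_norm_add ((z - z₀) * ratEval R z) (ε : ℂ)
    rw [Complex.norm_real, Real.norm_of_nonneg h.1.le] at h3
    rw [e]
    linarith [h.2]
  -- Without a pole at `z₀`, `(z - z₀) (R(z) + ε / (z - z₀))` would tend to `0`.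
  have hself : ∀ ε : ℝ, 0 < ε ∧ ε < c / 2 → IsPole (perturb R z₀ ε) z₀ := by
    intro ε h
    by_contra hnp
    have hcont : ContinuousAt (fun z => ‖(z - z₀) * ratEval (perturb R z₀ ε) z‖) z₀ :=
      ((by fun_prop : ContinuousAt (fun z => z - z₀) z₀).mul
        (analyticAt_ratEval hnp).continuousAt).norm
    have hsmall := (hcont.eventually_lt_const (u := c / 2) (by simpa using hc)).filter_mono
      (nhdsWithin_le_nhds (s := {z₀}ᶜ))
    have hnp' := ((isOpen_setOf_not_isPole _).eventually_mem hnp).filter_mono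
      (nhdsWithin_le_nhds (s := {z₀}ᶜ))
    obtain ⟨z, hz1, hz2, hz3, hz4⟩ :=
      (hsmall.and (hev.and (hnp'.and self_mem_nhdsWithin))).exists
    rw [ratEval_perturb ε hz4 (fun hz => hz3 ((isPole_perturb_iff hz4).mpr hz))] at hz1
    linarith [key h hz4 hz2]
  have hcont : ContinuousAt (fun z : ℂ => ‖(z - z₀) * conj z‖) z₀ := by fun_prop
  have hsmall := (hcont.eventually_lt_const (u := c / 2) (by simpa using hc)).prod_inr
    (𝓝[>] (0 : ℝ))
  have hev' := (eventually_nhdsWithin_iff.mp hev).prod_inr (𝓝[>] (0 : ℝ))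
  filter_upwards [hsmall, hev', hε.prod_inl (𝓝 z₀)] with x h1 h2 h3 hx
  by_cases hxz : x.2 = z₀
  · exact hx.1 (hxz ▸ hself x.1 h3)
  · obtain ⟨-, hx2⟩ := (mem_zeros_perturb_iff hxz).mp hx
    have h4 : ratEval R x.2 + x.1 / (x.2 - z₀) = conj x.2 := by
      rw [harm] at hx2
      linear_combination hx2
    have h5 := key h3 hxz (h2 hxz)
    rw [h4] at h5
    linarith

theorem eventually_notMem_zeros_perturb_of_harm_ne_zero {R : RatFunc ℂ} {z₀ p : ℂ}
    (hp : ¬ IsPole R p) (hne : p ≠ z₀) (h0 : harm R p ≠ 0) :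
    ∀ᶠ x in 𝓝[>] (0 : ℝ) ×ˢ 𝓝 p, x.2 ∉ zeros (perturb R z₀ x.1) := by
  have hcont : ContinuousAt (fun x : ℝ × ℂ => harm R x.2 + x.1 / (x.2 - z₀)) (0, p) := by
    have h1 : ContinuousAt (fun x : ℝ × ℂ => (x.1 : ℂ) / (x.2 - z₀)) (0, p) :=
      ContinuousAt.div (by fun_prop) (by fun_prop) (sub_ne_zero.mpr hne)
    have h2 : ContinuousAt (fun x : ℝ × ℂ => harm R x.2) (0, p) :=
      ContinuousAt.comp (f := fun x : ℝ × ℂ => x.2) (g := harm R)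
        (contDiffAt_harm hp).continuousAt continuousAt_snd
    exact h2.add h1
  have hsmall := hcont.eventually_ne (y := 0) (by simpa using h0)
  rw [nhds_prod_eq] at hsmall
  have hsmall' := hsmall.filter_mono (prod_mono_left _ (nhdsWithin_le_nhds (s := Set.Ioi 0)))
  have hne' := (isOpen_ne.eventually_mem hne).prod_inr (𝓝[>] (0 : ℝ))
  filter_upwards [hsmall', hne'] with x h1 h2 hx
  exact h1 ((mem_zeros_perturb_iff h2).mp hx).2

theorem eventually_cocompact_notMem_zeros_perturb {R : RatFunc ℂ}
    (hlim : Tendsto (harm R) (cocompact ℂ) (cocompact ℂ)) (z₀ : ℂ) :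
    ∀ᶠ x in 𝓝[>] (0 : ℝ) ×ˢ cocompact ℂ, x.2 ∉ zeros (perturb R z₀ x.1) := by
  have h1 : ∀ᶠ z in cocompact ℂ, 1 < ‖harm R z‖ :=
    ((tendsto_norm_cocompact_atTop).comp hlim).eventually_gt_atTop 1
  have h2 : ∀ᶠ z in cocompact ℂ, 1 + ‖z₀‖ < ‖z‖ :=
    (tendsto_norm_cocompact_atTop).eventually_gt_atTop _
  have h3 : ∀ᶠ ε : ℝ in 𝓝[>] 0, 0 < ε ∧ ε < 1 := Ioo_mem_nhdsGT one_pos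
  filter_upwards [h1.prod_inr _, h2.prod_inr _, h3.prod_inl _] with x hx1 hx2 hx3 hx
  have h4 : 1 < ‖x.2 - z₀‖ := by linarith [norm_sub_norm_le x.2 z₀]
  have hne : x.2 ≠ z₀ := by
    rintro h
    rw [h, sub_self, norm_zero] at h4
    linarith
  have h5 := ((mem_zeros_perturb_iff hne).mp hx).2
  rw [add_eq_zero_iff_eq_neg] at h5
  rw [h5, norm_neg, norm_div, Complex.norm_real, Real.norm_of_nonneg hx3.1.le,
    lt_div_iff₀ (by linarith)] at hx1
  linarith [hx3.2]

/-! ### Continuation of nondegenerate zeros -/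

/-- A form of the implicit function theorem: a zero with invertible (here: injective, as `ℂ` is
finite-dimensional over `ℝ`) derivative continues uniquely in a parameter. -/
theorem exists_zero_branch {G : ℝ × ℂ → ℂ} {p : ℂ} {L : ℂ →L[ℝ] ℂ}
    (hG : ContDiffAt ℝ 1 G (0, p)) (h0 : G (0, p) = 0)
    (hL : HasFDerivAt (fun z => G (0, z)) L p) (hinj : Function.Injective L) :
    ∃ φ : ℝ → ℂ, Tendsto φ (𝓝 0) (𝓝 p) ∧
      ∀ᶠ x in 𝓝 ((0 : ℝ), p), G x = 0 ↔ x.2 = φ x.1 := by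
  have hs := hG.hasStrictFDerivAt one_ne_zero
  have hcomp : (fderiv ℝ G (0, p)).comp (.inr ℝ ℝ ℂ) = L := by
    have h1 : HasFDerivAt (fun z : ℂ => ((0 : ℝ), z)) (.inr ℝ ℝ ℂ) p :=
      hasFDerivAt_prodMk_right 0 p
    exact (hs.hasFDerivAt.comp p h1).unique hL
  have hinv : ((fderiv ℝ G (0, p)).comp (.inr ℝ ℝ ℂ)).IsInvertible := by
    rw [hcomp]
    exact ⟨(LinearEquiv.ofInjectiveEndo L.toLinearMap hinj).toContinuousLinearEquiv, by ext1; rfl⟩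
  refine ⟨hs.implicitFunctionOfProdDomain hinv, hs.tendsto_implicitFunctionOfProdDomain hinv, ?_⟩
  filter_upwards [hs.eventually_apply_eq_iff_implicitFunctionOfProdDomain hinv] with x hx
  rw [h0] at hx
  rw [hx, eq_comm]

theorem eventually_apply_branch {G : ℝ × ℂ → ℂ} {p : ℂ} {φ : ℝ → ℂ}
    (hφ : Tendsto φ (𝓝 0) (𝓝 p)) (h : ∀ᶠ x in 𝓝 ((0 : ℝ), p), G x = 0 ↔ x.2 = φ x.1) :
    ∀ᶠ t in 𝓝 0, G (t, φ t) = 0 := by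
  have : Tendsto (fun t => (t, φ t)) (𝓝 0) (𝓝 ((0 : ℝ), p)) := tendsto_id.prodMk_nhds hφ
  filter_upwards [this.eventually h] with t ht
  exact ht.mpr rfl

theorem hasFDerivAt_sub_conj {g : ℂ → ℂ} {a p : ℂ} (h : HasDerivAt g a p) :
    HasFDerivAt (fun z => g z - conj z)
      ((ContinuousLinearMap.mul ℝ ℂ a) - (Complex.conjCLE : ℂ →L[ℝ] ℂ)) p := by
  have h1 : HasFDerivAt g (ContinuousLinearMap.mul ℝ ℂ a) p := by
    have h2 : ContinuousLinearMap.mul ℝ ℂ a =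
        (ContinuousLinearMap.toSpanSingleton ℂ a).restrictScalars ℝ := by
      ext z
      simp [mul_comm]
    rw [h2]
    exact h.hasFDerivAt.restrictScalars ℝ
  exact h1.fun_sub Complex.conjCLE.hasFDerivAt

/-- The differential `ζ ↦ a ζ - conj ζ` of `R(z) - conj z` is invertible unless `|a| = 1`. -/
theorem injective_mul_sub_conj {a : ℂ} (ha : ‖a‖ ≠ 1) :
    Function.Injective
      ((ContinuousLinearMap.mul ℝ ℂ a) - (Complex.conjCLE : ℂ →L[ℝ] ℂ)) := by
  rw [injective_iff_map_eq_zero]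
  intro z hz
  have h1 : a * z = conj z := sub_eq_zero.mp (by simpa using hz)
  have h2 : ‖a‖ * ‖z‖ = ‖z‖ := by rw [← norm_mul, h1, Complex.norm_conj]
  by_contra h
  exact ha (mul_right_cancel₀ (norm_ne_zero_iff.mpr h) (h2.trans (one_mul _).symm))

/-- A regular zero `p ≠ z₀` of `f` continues to a unique nearby zero of `F`. -/
theorem exists_zeros_perturb_branch {R : RatFunc ℂ} {z₀ p : ℂ} (hp : p ∈ zeros R)
    (hns : ‖deriv (ratEval R) p‖ ≠ 1) (hne : p ≠ z₀) :
    ∃ φ : ℝ → ℂ, Tendsto φ (𝓝 0) (𝓝 p) ∧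
      ∀ᶠ x in 𝓝 ((0 : ℝ), p), x.2 ∈ zeros (perturb R z₀ x.1) ↔ x.2 = φ x.1 := by
  have hG : ContDiffAt ℝ 1 (fun x : ℝ × ℂ => harm R x.2 + x.1 / (x.2 - z₀)) (0, p) := by
    have h1 : ContDiffAt ℝ 1 (fun x : ℝ × ℂ => harm R x.2) (0, p) :=
      ContDiffAt.comp (f := fun x : ℝ × ℂ => x.2) (g := harm R) (0, p)
        (contDiffAt_harm hp.1) contDiffAt_snd
    have h2 : ContDiffAt ℝ 1 (fun x : ℝ × ℂ => (x.1 : ℂ)) (0, p) :=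
      (Complex.ofRealCLM.contDiff.comp contDiff_fst).contDiffAt
    have h3 : ContDiffAt ℝ 1 (fun x : ℝ × ℂ => x.2 - z₀) (0, p) := by fun_prop
    simp only [div_eq_mul_inv]
    exact h1.add (h2.mul (h3.inv (sub_ne_zero.mpr hne)))
  have hL := hasFDerivAt_sub_conj (analyticAt_ratEval hp.1).differentiableAt.hasDerivAt
  obtain ⟨φ, hφ, hev⟩ := exists_zero_branch hG (by simpa using hp.2)
    (by simpa [harm] using hL) (injective_mul_sub_conj hns)
  refine ⟨φ, hφ, ?_⟩
  have h1 : ∀ᶠ x in 𝓝 ((0 : ℝ), p), ¬ IsPole R x.2 :=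
    (continuousAt_snd (p := ((0 : ℝ), p))).eventually 
      ((isOpen_setOf_not_isPole R).eventually_mem hp.1)
  have h2 : ∀ᶠ x in 𝓝 ((0 : ℝ), p), x.2 ≠ z₀ :=
    (continuousAt_snd (p := ((0 : ℝ), p))).eventually (isOpen_ne.eventually_mem hne)
  filter_upwards [hev, h1, h2] with x hx hx1 hx2
  rw [mem_zeros_perturb_iff hx2, ← hx]
  exact and_iff_right hx1

/-! ### Counting the zeros away from `z₀` -/

/-- Compactness of `ℂ ∪ {∞}`: a property that holds for all parameters far enough along `l`,
locally at each point of `ℂ` and near infinity, holds on all of `ℂ` eventually. -/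
theorem eventually_forall_of_local {ι : Type*} {l : Filter ι} {P : ι → ℂ → Prop}
    (hloc : ∀ p, ∀ᶠ x in l ×ˢ 𝓝 p, P x.1 x.2) (hinf : ∀ᶠ x in l ×ˢ cocompact ℂ, P x.1 x.2) :
    ∀ᶠ t in l, ∀ z, P t z := by
  obtain ⟨A, hA, B, hB, hAB⟩ := eventually_prod_iff.mp hinf
  obtain ⟨K, hK, hKB⟩ := mem_cocompact.mp hB
  obtain ⟨C, hC, D, hD, hCD⟩ := eventually_prod_iff.mp
    (hK.mem_prod_nhdsSet_of_forall (s := {x : ι × ℂ | P x.1 x.2}) fun p _ => hloc p)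
  filter_upwards [hA, hC] with t htA htC z
  by_cases hz : z ∈ K
  · exact hCD htC (subset_of_mem_nhdsSet hD hz)
  · exact hAB htA (hKB hz)

/-- If near each point of `Z` the set `S t` consists of a single point converging to it, and `S t`
has no points near other points of `ℂ ∪ {∞}`, then `S t` and `Z` are eventually equinumerous. -/
theorem eventually_sameFiniteCard {l : Filter ℝ} {S : ℝ → Set ℂ} {Z : Set ℂ} (hZ : Z.Finite)
    (hbranch : ∀ p ∈ Z, ∃ φ : ℝ → ℂ, Tendsto φ l (𝓝 p) ∧
      ∀ᶠ x in l ×ˢ 𝓝 p, x.2 ∈ S x.1 ↔ x.2 = φ x.1)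
    (hloc : ∀ p ∉ Z, ∀ᶠ x in l ×ˢ 𝓝 p, x.2 ∉ S x.1)
    (hinf : ∀ᶠ x in l ×ˢ cocompact ℂ, x.2 ∉ S x.1) :
    ∀ᶠ t in l, SameFiniteCard (S t) Z := by
  choose! φ hφ hev using hbranch
  have h1 : ∀ᶠ t in l, ∀ p ∈ Z, φ p t ∈ S t := by
    rw [eventually_all_finite hZ]
    intro p hp
    have : Tendsto (fun t => (t, φ p t)) l (l ×ˢ 𝓝 p) := tendsto_id.prodMk (hφ p hp)
    filter_upwards [this.eventually (hev p hp)] with t ht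
    exact ht.mpr rfl
  have h2 : ∀ᶠ t in l, ∀ z, z ∈ S t → ∃ p ∈ Z, φ p t = z := by
    refine eventually_forall_of_local (fun p => ?_) ?_
    · by_cases hp : p ∈ Z
      · filter_upwards [hev p hp] with x hx hxS
        exact ⟨p, hp, (hx.mp hxS).symm⟩
      · filter_upwards [hloc p hp] with x hx hxS
        exact absurd hxS hx
    · filter_upwards [hinf] with x hx hxS
      exact absurd hxS hx
  have h3 : ∀ᶠ t in l, ∀ p ∈ Z, ∀ q ∈ Z, p ≠ q → φ p t ≠ φ q t := by
    simp only [eventually_all_finite hZ]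
    intro p hp q hq
    by_cases hpq : p = q
    · exact Eventually.of_forall fun _ h => absurd hpq h
    · filter_upwards [((hφ p hp).sub (hφ q hq)).eventually_ne (sub_ne_zero.mpr hpq)] with t ht _
      exact sub_ne_zero.mp ht
  filter_upwards [h1, h2, h3] with t ht1 ht2 ht3
  have himg : (fun p => φ p t) '' Z = S t := by
    ext z
    exact ⟨fun ⟨p, hp, h⟩ => h ▸ ht1 p hp, fun h => ht2 z h⟩
  have hinj : Set.InjOn (fun p => φ p t) Z := fun p hp q hq h =>
    by_contra fun hpq => ht3 p hp q hq hpq h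
  rw [SameFiniteCard, ← himg]
  exact ⟨hZ.image _, hZ, hinj.ncard_image⟩

/-- The zeros of `f` do not accumulate in `ℂ`: regular zeros are isolated by
`exists_zeros_perturb_branch` at `ε = 0`. -/
theorem eventually_eq_of_mem_zeros {R : RatFunc ℂ} (hreg : IsRegular R) (p : ℂ) :
    ∀ᶠ z in 𝓝 p, z ∈ zeros R → z = p := by
  by_cases hp : IsPole R p
  · obtain ⟨c, hc, hev⟩ := hp.exists_le_norm_sub_mul
    have hcont : ContinuousAt (fun z : ℂ => ‖(z - p) * conj z‖) p := by fun_prop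
    filter_upwards [eventually_nhdsWithin_iff.mp hev,
      hcont.eventually_lt_const (u := c) (by simpa using hc)] with z h1 h2 h3
    by_contra hz
    have h4 := h1 hz
    rw [show ratEval R z = conj z from sub_eq_zero.mp h3.2] at h4
    linarith
  · by_cases h0 : harm R p = 0
    · obtain ⟨φ, -, hev⟩ := exists_zeros_perturb_branch (z₀ := p + 1) ⟨hp, h0⟩
        (hreg p ⟨hp, h0⟩) (by simp)
      have hperturb : perturb R (p + 1) 0 = R := by simp [perturb]
      have hp' := hev.self_of_nhds
      simp only [hperturb] at hp'
      have : Tendsto (fun z : ℂ => ((0 : ℝ), z)) (𝓝 p) (𝓝 (0, p)) :=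
        (Continuous.prodMk_right (0 : ℝ)).tendsto p
      filter_upwards [this.eventually hev] with z hz hz'
      simp only [hperturb] at hz
      rw [hz.mp hz', ← hp'.mp ⟨hp, h0⟩]
    · filter_upwards [(contDiffAt_harm hp).continuousAt.eventually_ne h0] with z hz hz'
      exact absurd hz'.2 hz

theorem finite_zeros {R : RatFunc ℂ} (hreg : IsRegular R)
    (hlim : Tendsto (harm R) (cocompact ℂ) (cocompact ℂ)) : (zeros R).Finite := by
  have h1 : ∀ᶠ z in cocompact ℂ, 0 < ‖harm R z‖ :=
    ((tendsto_norm_cocompact_atTop).comp hlim).eventually_gt_atTop 0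
  obtain ⟨K, hK, hKsub⟩ := mem_cocompact.mp h1
  have hsub : zeros R ⊆ K := fun z hz => by
    by_contra hzK
    have : 0 < ‖harm R z‖ := hKsub hzK
    rw [hz.2, norm_zero] at this
    exact lt_irrefl _ this
  have hfin : (K ∩ zeros R).Finite := by
    refine hK.induction_on (p := fun s => (s ∩ zeros R).Finite) (by simp)
      (fun s t hst ht => ht.subset (Set.inter_subset_inter_left _ hst))
      (fun s t hs ht => by rw [Set.union_inter_distrib_right]; exact hs.union ht) fun p _ => ?_
    exact ⟨_, mem_nhdsWithin_of_mem_nhds (eventually_eq_of_mem_zeros hreg p),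
      (Set.finite_singleton p).subset fun z hz => hz.1 hz.2⟩
  rwa [Set.inter_eq_right.mpr hsub] at hfin

/-- The count outside the disk. For `r = 0` the disk is empty, and `hloc` asks that the zeros of `F`
stay away from `z₀`. -/
theorem eventually_sameFiniteCard_zeros_diff_ball {R : RatFunc ℂ} (hreg : IsRegular R)
    (hlim : Tendsto (harm R) (cocompact ℂ) (cocompact ℂ)) {z₀ : ℂ} {r : ℝ} (hr : 0 ≤ r)
    (hsphere : ∀ p ∈ zeros R, dist p z₀ ≠ r)
    (hloc : ∀ᶠ x in 𝓝[>] (0 : ℝ) ×ˢ 𝓝 z₀, x.2 ∉ zeros (perturb R z₀ x.1) \ Metric.ball z₀ r) :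
    ∀ᶠ ε in 𝓝[>] (0 : ℝ), SameFiniteCard (zeros (perturb R z₀ ε) \ Metric.ball z₀ r)
      (zeros R \ Metric.ball z₀ r) := by
  have hz₀ : z₀ ∉ zeros R \ Metric.ball z₀ r := by
    rintro ⟨h1, h2⟩
    have h3 := hsphere z₀ h1
    rw [Metric.mem_ball, dist_self, not_lt] at h2
    rw [dist_self] at h3
    exact h3 (le_antisymm hr h2)
  refine eventually_sameFiniteCard ((finite_zeros hreg hlim).subset Set.sdiff_subset)
    (fun p hp => ?_) (fun p hp => ?_) ?_
  · have hne : p ≠ z₀ := fun h => hz₀ (h ▸ hp)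
    obtain ⟨φ, hφ, hev⟩ := exists_zeros_perturb_branch hp.1 (hreg p hp.1) hne
    refine ⟨φ, hφ.mono_left nhdsWithin_le_nhds, ?_⟩
    rw [nhds_prod_eq] at hev
    have hout : p ∈ (Metric.closedBall z₀ r)ᶜ := by
      rw [Set.mem_compl_iff, Metric.mem_closedBall, not_le]
      exact lt_of_le_of_ne (not_lt.mp hp.2) (hsphere p hp.1).symm
    filter_upwards [hev.filter_mono (prod_mono_left _ nhdsWithin_le_nhds),
      (Metric.isClosed_closedBall.isOpen_compl.eventually_mem hout).prod_inr _] with x h1 h2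
    rw [← h1]
    exact and_iff_left fun h => h2 (Metric.ball_subset_closedBall h)
  · by_cases hne : p = z₀
    · exact hne ▸ hloc
    by_cases hpole : IsPole R p
    · exact (hpole.eventually_notMem_zeros_perturb hne).mono fun x hx h => hx h.1
    by_cases h0 : harm R p = 0
    · have hin : p ∈ Metric.ball z₀ r := by_contra fun h => hp ⟨⟨hpole, h0⟩, h⟩
      exact ((Metric.isOpen_ball.eventually_mem hin).prod_inr _).mono fun x hx h => h.2 hx
    · exact (eventually_notMem_zeros_perturb_of_harm_ne_zero hpole hne h0).mono
        fun x hx h => hx h.1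
  · exact (eventually_cocompact_notMem_zeros_perturb hlim z₀).mono fun x hx h => hx h.1

/-! ### Zeros created near `z₀` -/

/-- The zero of `F` created near a point `z₀` with `f(z₀) ≠ 0`. In the coordinate `z = z₀ + ε u`
the equation `F(z) = 0` becomes `f(z₀ + ε u) + 1 / u = 0`, with the simple root `u = -1 / f(z₀)` at
`ε = 0`; the derivative `R'(z) - 1 / (ε u ^ 2)` of the analytic part blows up as `ε` tends to
`0`. -/
theorem eventually_one_le_encard_sensePreservingZeros {R : RatFunc ℂ} {z₀ : ℂ}
    (hz₀ : ¬ IsPole R z₀) (h0 : harm R z₀ ≠ 0) {r : ℝ} (hr : 0 < r) :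
    ∀ᶠ ε in 𝓝[>] (0 : ℝ),
      1 ≤ (sensePreservingZeros (perturb R z₀ ε) ∩ Metric.ball z₀ r).encard := by
  set w := harm R z₀ with hw
  have hu₀ : -w⁻¹ ≠ 0 := neg_ne_zero.mpr (inv_ne_zero h0)
  have hz : ContDiff ℝ 1 (fun x : ℝ × ℂ => z₀ + x.1 * x.2) :=
    contDiff_const.add ((Complex.ofRealCLM.contDiff.comp contDiff_fst).mul contDiff_snd)
  have hG : ContDiffAt ℝ 1 (fun x : ℝ × ℂ => harm R (z₀ + x.1 * x.2) + x.2⁻¹) (0, -w⁻¹) := by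
    have h1 : ContDiffAt ℝ 1 (fun x : ℝ × ℂ => harm R (z₀ + x.1 * x.2)) (0, -w⁻¹) :=
      ContDiffAt.comp (f := fun x : ℝ × ℂ => z₀ + x.1 * x.2) (g := harm R) (0, -w⁻¹)
        (contDiffAt_harm (by simpa using hz₀)) hz.contDiffAt
    exact h1.add (contDiffAt_snd.inv hu₀)
  have hL : HasFDerivAt (fun u : ℂ => w + u⁻¹)
      ((ContinuousLinearMap.toSpanSingleton ℂ (-((-w⁻¹) ^ 2)⁻¹)).restrictScalars ℝ) (-w⁻¹) :=
    ((hasDerivAt_inv hu₀).const_add w).hasFDerivAt.restrictScalars ℝ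
  have hinj : Function.Injective
      ((ContinuousLinearMap.toSpanSingleton ℂ (-((-w⁻¹) ^ 2)⁻¹)).restrictScalars ℝ) := by
    rw [injective_iff_map_eq_zero]
    intro z hz
    simpa [h0] using hz
  obtain ⟨φ, hφ, hev⟩ := exists_zero_branch hG (by simp [← hw]) (by simpa [← hw] using hL) hinj
  have hzero := (eventually_apply_branch hφ hev).filter_mono
    (nhdsWithin_le_nhds (s := Set.Ioi 0))
  have hφ' : Tendsto φ (𝓝[>] 0) (𝓝 (-w⁻¹)) := hφ.mono_left nhdsWithin_le_nhds
  have hs : Tendsto (fun s : ℝ => (s : ℂ)) (𝓝[>] 0) (𝓝 0) :=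
    (Complex.continuous_ofReal.tendsto' 0 0 (by simp)).mono_left nhdsWithin_le_nhds
  have hzt : Tendsto (fun s : ℝ => z₀ + s * φ s) (𝓝[>] 0) (𝓝 z₀) := by
    simpa using (hs.mul hφ').const_add z₀
  have hder : Tendsto (fun s : ℝ => ‖s * deriv (ratEval R) (z₀ + s * φ s) - 1 / φ s ^ 2‖)
      (𝓝[>] 0) (𝓝 ‖(1 : ℂ) / (-w⁻¹) ^ 2‖) := by
    have h1 := (analyticAt_ratEval hz₀).deriv.continuousAt.tendsto.comp hzt
    simpa using ((hs.mul h1).sub ((hφ'.pow 2).inv₀ (pow_ne_zero 2 hu₀))).norm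
  have hlt : ∀ᶠ s : ℝ in 𝓝[>] 0,
      s < ‖s * deriv (ratEval R) (z₀ + s * φ s) - 1 / φ s ^ 2‖ :=
    (tendsto_nhdsWithin_of_tendsto_nhds tendsto_id).eventually_lt hder
      (norm_pos_iff.mpr (one_div_ne_zero (pow_ne_zero 2 hu₀)))
  filter_upwards [hzero, hφ'.eventually_ne hu₀, hlt, hzt.eventually
    ((isOpen_setOf_not_isPole R).mem_nhds hz₀), hzt.eventually (Metric.ball_mem_nhds z₀ hr),
    self_mem_nhdsWithin] with s h1 h2 h3 h4 h5 (h6 : 0 < s)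
  have hs0 : (s : ℂ) ≠ 0 := by exact_mod_cast h6.ne'
  have hne : z₀ + s * φ s ≠ z₀ := by simp [hs0, h2]
  rw [Set.one_le_encard_iff_nonempty]
  refine ⟨z₀ + s * φ s, ⟨(mem_zeros_perturb_iff hne).mpr ⟨h4, ?_⟩, ?_⟩, h5⟩
  · rw [← h1, add_sub_cancel_left]
    field_simp
  · rw [deriv_ratEval_perturb s hne h4, add_sub_cancel_left]
    have e : deriv (ratEval R) (z₀ + s * φ s) - s / (s * φ s) ^ 2 =
        (s * deriv (ratEval R) (z₀ + s * φ s) - 1 / φ s ^ 2) / s := by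
      field_simp
    rw [e, norm_div, Complex.norm_real, Real.norm_of_nonneg h6.le, one_lt_div h6]
    exact h3

/-- Second-order Taylor expansion with analytic remainder. -/
theorem exists_taylor_two {g : ℂ → ℂ} {p : ℂ} (hg : AnalyticAt ℂ g p) :
    ∃ h : ℂ → ℂ, AnalyticAt ℂ h p ∧
      ∀ᶠ z in 𝓝 p, g z = g p + deriv g p * (z - p) + (z - p) ^ 2 * h z := by
  have hF : AnalyticAt ℂ (fun z => g z - g p - deriv g p * (z - p)) p := by fun_prop
  have hord : ((2 : ℕ) : ℕ∞) ≤ analyticOrderAt (fun z => g z - g p - deriv g p * (z - p)) p := by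
    rw [natCast_le_analyticOrderAt_iff_iteratedDeriv_eq_zero hF]
    intro i hi
    interval_cases i
    · simp
    · have := ((hg.differentiableAt.hasDerivAt.sub_const (g p)).fun_sub
        (((hasDerivAt_id p).sub_const p).const_mul (deriv g p))).deriv
      simpa [iteratedDeriv_one] using this
  obtain ⟨h, hh, hev⟩ := (natCast_le_analyticOrderAt hF).mp hord
  refine ⟨h, hh, hev.mono fun z hz => ?_⟩
  rw [smul_eq_mul] at hz
  linear_combination hz

/-- Zeros of `F` near a zero `z₀` of `f`. With `a = R'(z₀)`, `ε = s ^ 2` and `z = z₀ + s u`, the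
equation `F(z) = 0` divided by `s` is a `C¹` perturbation of `a u - conj u + 1 / u = 0`, and the
derivative of the analytic part of `F` at `z` tends to `a - 1 / u ^ 2`. By symmetry a root `u₀` of
the limit equation comes with the root `-u₀`, so each nondegenerate root yields one zero here. -/
theorem exists_rescaled_branch {R : RatFunc ℂ} {z₀ u₀ : ℂ} (hz₀ : z₀ ∈ zeros R) (hu₀ : u₀ ≠ 0)
    (hroot : deriv (ratEval R) z₀ * u₀ + u₀⁻¹ = conj u₀)
    (hnd : ‖deriv (ratEval R) z₀ - (u₀ ^ 2)⁻¹‖ ≠ 1) :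
    ∃ φ : ℝ → ℂ, Tendsto φ (𝓝[>] 0) (𝓝 u₀) ∧
      (∀ᶠ s : ℝ in 𝓝[>] 0, z₀ + s * φ s ∈ zeros (perturb R z₀ (s ^ 2))) ∧
      Tendsto (fun s : ℝ => deriv (ratEval (perturb R z₀ (s ^ 2))) (z₀ + s * φ s)) (𝓝[>] 0)
        (𝓝 (deriv (ratEval R) z₀ - (u₀ ^ 2)⁻¹)) := by
  have han := analyticAt_ratEval hz₀.1
  obtain ⟨h, hh, htaylor⟩ := exists_taylor_two han
  set a := deriv (ratEval R) z₀ with ha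
  have hofReal : ContDiff ℝ 1 (fun x : ℝ × ℂ => (x.1 : ℂ)) :=
    Complex.ofRealCLM.contDiff.comp contDiff_fst
  have hz : ContDiff ℝ 1 (fun x : ℝ × ℂ => z₀ + x.1 * x.2) :=
    contDiff_const.add (hofReal.mul contDiff_snd)
  -- `F(z₀ + s u) / s`, with the second-order remainder of `R` written as `s u ^ 2 h`, so that it
  -- makes sense and is smooth at `s = 0`.
  have hG : ContDiffAt ℝ 1 (fun x : ℝ × ℂ => a * x.2 + x.2⁻¹ - conj x.2 +
      x.1 * x.2 ^ 2 * h (z₀ + x.1 * x.2)) (0, u₀) := by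
    have h1 : ContDiffAt ℝ 1 (fun x : ℝ × ℂ => h (z₀ + x.1 * x.2)) (0, u₀) :=
      ContDiffAt.comp (f := fun x : ℝ × ℂ => z₀ + x.1 * x.2) (g := h) (0, u₀)
        (by simpa using hh.contDiffAt.restrict_scalars ℝ) hz.contDiffAt
    have h2 : ContDiffAt ℝ 1 (fun x : ℝ × ℂ => conj x.2) (0, u₀) :=
      (Complex.conjCLE.contDiff.comp contDiff_snd).contDiffAt
    exact (((contDiffAt_const.mul contDiffAt_snd).add (contDiffAt_snd.inv hu₀)).sub h2).add
      ((hofReal.contDiffAt.mul (contDiffAt_snd.pow 2)).mul h1)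
  have hL : HasFDerivAt (fun u : ℂ => a * u + u⁻¹ - conj u)
      ((ContinuousLinearMap.mul ℝ ℂ (a - (u₀ ^ 2)⁻¹)) - (Complex.conjCLE : ℂ →L[ℝ] ℂ)) u₀ := by
    apply hasFDerivAt_sub_conj
    simpa [sub_eq_add_neg] using ((hasDerivAt_id u₀).const_mul a).fun_add (hasDerivAt_inv hu₀)
  obtain ⟨φ, hφ, hev⟩ := exists_zero_branch hG (by simp [hroot]) (by simpa using hL)
    (injective_mul_sub_conj hnd)
  have hzero := (eventually_apply_branch hφ hev).filter_mono
    (nhdsWithin_le_nhds (s := Set.Ioi 0))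
  have hφ' : Tendsto φ (𝓝[>] 0) (𝓝 u₀) := hφ.mono_left nhdsWithin_le_nhds
  have hs : Tendsto (fun s : ℝ => (s : ℂ)) (𝓝[>] 0) (𝓝 0) :=
    (Complex.continuous_ofReal.tendsto' 0 0 (by simp)).mono_left nhdsWithin_le_nhds
  have hzt : Tendsto (fun s : ℝ => z₀ + s * φ s) (𝓝[>] 0) (𝓝 z₀) := by
    simpa using (hs.mul hφ').const_add z₀
  have hgood : ∀ᶠ s : ℝ in 𝓝[>] 0, (s : ℂ) ≠ 0 ∧ φ s ≠ 0 ∧ z₀ + s * φ s ≠ z₀ ∧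
      ¬ IsPole R (z₀ + s * φ s) := by
    filter_upwards [hφ'.eventually_ne hu₀, hzt.eventually
      ((isOpen_setOf_not_isPole R).mem_nhds hz₀.1), self_mem_nhdsWithin] with s h1 h2 (h3 : 0 < s)
    have hs0 : (s : ℂ) ≠ 0 := by exact_mod_cast h3.ne'
    exact ⟨hs0, h1, by simp [hs0, h1], h2⟩
  refine ⟨φ, hφ', ?_, ?_⟩
  · filter_upwards [hzero, hgood, hzt.eventually htaylor] with s h1 ⟨h2, h3, h4, h5⟩ h6
    refine (mem_zeros_perturb_iff h4).mpr ⟨h5, ?_⟩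
    have hRz₀ : ratEval R z₀ = conj z₀ := sub_eq_zero.mp hz₀.2
    have e : ((s ^ 2 : ℝ) : ℂ) / (z₀ + s * φ s - z₀) = s * (φ s)⁻¹ := by
      push_cast
      rw [add_sub_cancel_left]
      field_simp
    rw [harm, h6, hRz₀, e]
    simp only [map_add, map_mul, Complex.conj_ofReal]
    linear_combination (s : ℂ) * h1
  · have h1 := (han.deriv.continuousAt.tendsto.comp hzt).sub
      ((hφ'.pow 2).inv₀ (pow_ne_zero 2 hu₀))
    refine h1.congr' ?_
    filter_upwards [hgood] with s ⟨h2, h3, h4, h5⟩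
    rw [deriv_ratEval_perturb _ h4 h5, add_sub_cancel_left, Function.comp_apply]
    push_cast
    field_simp

/-- Here `O` is the set of derivatives allowed: `{w | 1 < |w|}` for sense-preserving and
`{w | |w| < 1}` for sense-reversing zeros. -/
theorem eventually_two_le_encard {R : RatFunc ℂ} {z₀ u₀ : ℂ} {O : Set ℂ} (hO : IsOpen O)
    (hz₀ : z₀ ∈ zeros R) (hu₀ : u₀ ≠ 0)
    (hroot : deriv (ratEval R) z₀ * u₀ + u₀⁻¹ = conj u₀)
    (hnd : ‖deriv (ratEval R) z₀ - (u₀ ^ 2)⁻¹‖ ≠ 1)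
    (hmem : deriv (ratEval R) z₀ - (u₀ ^ 2)⁻¹ ∈ O) {r : ℝ} (hr : 0 < r) :
    ∀ᶠ ε in 𝓝[>] (0 : ℝ), 2 ≤ ({z | z ∈ zeros (perturb R z₀ ε) ∧
      deriv (ratEval (perturb R z₀ ε)) z ∈ O} ∩ Metric.ball z₀ r).encard := by
  obtain ⟨φ, hφ, hφz, hφd⟩ := exists_rescaled_branch hz₀ hu₀ hroot hnd
  obtain ⟨ψ, hψ, hψz, hψd⟩ := exists_rescaled_branch hz₀ (neg_ne_zero.mpr hu₀)
    (by rw [map_neg, ← hroot, inv_neg]; ring) (by rwa [neg_sq])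
  rw [neg_sq] at hψd
  have hs : Tendsto (fun s : ℝ => (s : ℂ)) (𝓝[>] 0) (𝓝 0) :=
    (Complex.continuous_ofReal.tendsto' 0 0 (by simp)).mono_left nhdsWithin_le_nhds
  have hball {χ : ℝ → ℂ} {u : ℂ} (hχ : Tendsto χ (𝓝[>] 0) (𝓝 u)) :
      ∀ᶠ s : ℝ in 𝓝[>] 0, z₀ + s * χ s ∈ Metric.ball z₀ r := by
    have hzt : Tendsto (fun s : ℝ => z₀ + s * χ s) (𝓝[>] 0) (𝓝 z₀) := by
      simpa using (hs.mul hχ).const_add z₀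
    exact hzt.eventually (Metric.ball_mem_nhds z₀ hr)
  have hsq : ∀ᶠ s : ℝ in 𝓝[>] 0, 2 ≤ ({z | z ∈ zeros (perturb R z₀ (s ^ 2)) ∧
      deriv (ratEval (perturb R z₀ (s ^ 2))) z ∈ O} ∩ Metric.ball z₀ r).encard := by
    filter_upwards [hφz, hψz, hφd.eventually (hO.mem_nhds hmem),
      hψd.eventually (hO.mem_nhds hmem), hball hφ, hball hψ,
      (hφ.sub hψ).eventually_ne (sub_ne_zero.mpr (self_ne_neg.mpr hu₀)), self_mem_nhdsWithin]
      with s h1 h2 h3 h4 h5 h6 h7 (h8 : 0 < s)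
    have hs0 : (s : ℂ) ≠ 0 := by exact_mod_cast h8.ne'
    have hne : z₀ + s * φ s ≠ z₀ + s * ψ s := fun h =>
      h7 (sub_eq_zero.mpr (mul_left_cancel₀ hs0 (add_left_cancel h)))
    rw [← Set.encard_pair hne]
    refine Set.encard_le_encard (Set.insert_subset ⟨⟨h1, h3⟩, h5⟩ ?_)
    exact Set.singleton_subset_iff.mpr ⟨⟨h2, h4⟩, h6⟩
  have hsqrt : Tendsto Real.sqrt (𝓝[>] 0) (𝓝[>] 0) := by
    refine tendsto_nhdsWithin_of_tendsto_nhds_of_eventually_within _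
      ((Real.continuous_sqrt.tendsto' 0 0 Real.sqrt_zero).mono_left nhdsWithin_le_nhds) ?_
    filter_upwards [self_mem_nhdsWithin] with s hs using Real.sqrt_pos.mpr hs
  filter_upwards [hsqrt.eventually hsq, self_mem_nhdsWithin] with ε h1 (h2 : 0 < ε)
  rwa [Real.sq_sqrt h2.le] at h1

/-- Roots of the limit equation. Multiplied by `u` it reads `a u ^ 2 = |u| ^ 2 - 1`, so `a u ^ 2` is
real; `τ = ±1` is its sign, and `|u| ^ 2 = 1 / (1 - τ |a|)`. -/
theorem exists_root_limit_equation {a : ℂ} (ha : a ≠ 0) {τ : ℝ} (hτ : τ ^ 2 = 1)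
    (hpos : 0 < 1 - τ * ‖a‖) :
    ∃ u : ℂ, u ≠ 0 ∧ a * u + u⁻¹ = conj u ∧ ‖a - (u ^ 2)⁻¹‖ = |2 * ‖a‖ - τ| := by
  have hna : 0 < ‖a‖ := norm_pos_iff.mpr ha
  have hτ0 : τ ≠ 0 := fun h => by simp [h] at hτ
  -- The equation forces `a u ^ 2 = |u| ^ 2 - 1 = τ |a| / (1 - τ |a|)`.
  obtain ⟨u, hu⟩ := IsAlgClosed.exists_pow_nat_eq
    (((τ * ‖a‖ / (1 - τ * ‖a‖) : ℝ) : ℂ) / a) (n := 2) two_pos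
  have hpos' : ((1 : ℂ) - τ * ‖a‖) ≠ 0 := by exact_mod_cast hpos.ne'
  have hna' : (‖a‖ : ℂ) ≠ 0 := by exact_mod_cast hna.ne'
  have hτ0' : (τ : ℂ) ≠ 0 := by exact_mod_cast hτ0
  have hτ' : (τ : ℂ) ^ 2 = 1 := by exact_mod_cast hτ
  have hτabs : |τ| = 1 := by
    rcases sq_eq_one_iff.mp hτ with h | h <;> simp [h]
  have hu0 : u ≠ 0 := by
    rintro rfl
    rw [zero_pow two_ne_zero, eq_comm, div_eq_zero_iff] at hu
    rcases hu with h | h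
    · have h' : τ * ‖a‖ / (1 - τ * ‖a‖) = 0 := by exact_mod_cast h
      rw [div_eq_zero_iff] at h'
      rcases h' with h' | h'
      · exact (mul_ne_zero hτ0 hna.ne') h'
      · exact hpos.ne' h'
    · exact ha h
  have hnorm : ‖u‖ ^ 2 = 1 / (1 - τ * ‖a‖) := by
    rw [← norm_pow, hu, norm_div, Complex.norm_real, Real.norm_eq_abs, abs_div, abs_mul, hτabs,
      abs_norm, abs_of_pos hpos]
    field_simp
  have hconj : u * conj u = 1 / (1 - τ * ‖a‖) := by
    rw [Complex.mul_conj, Complex.normSq_eq_norm_sq, hnorm]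
    push_cast
    rfl
  refine ⟨u, hu0, ?_, ?_⟩
  · apply mul_left_cancel₀ hu0
    rw [hconj, mul_add, mul_inv_cancel₀ hu0]
    have : u * (a * u) = a * u ^ 2 := by ring
    rw [this, hu]
    push_cast
    field_simp
    ring
  · have e : a - (u ^ 2)⁻¹ = a / ‖a‖ * ((2 * ‖a‖ - τ : ℝ) : ℂ) := by
      rw [hu]
      push_cast
      field_simp
      linear_combination hτ'
    rw [e, norm_mul, norm_div, Complex.norm_real, Complex.norm_real, norm_norm, div_self hna.ne',
      one_mul, Real.norm_eq_abs]

/-- The roots with `τ = -1` exist for every `a = R'(z₀) ≠ 0`, and there the limit derivative has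
modulus `2 |a| + 1`. -/
theorem eventually_two_le_encard_sensePreservingZeros {R : RatFunc ℂ} {z₀ : ℂ}
    (hz₀ : z₀ ∈ zeros R) (ha : deriv (ratEval R) z₀ ≠ 0) {r : ℝ} (hr : 0 < r) :
    ∀ᶠ ε in 𝓝[>] (0 : ℝ),
      2 ≤ (sensePreservingZeros (perturb R z₀ ε) ∩ Metric.ball z₀ r).encard := by
  have hna := norm_pos_iff.mpr ha
  obtain ⟨u, hu0, hroot, hn⟩ := exists_root_limit_equation ha (τ := -1) (by norm_num) (by linarith)
  have h1 : 1 < ‖deriv (ratEval R) z₀ - (u ^ 2)⁻¹‖ := by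
    rw [hn, abs_of_pos (by linarith)]
    linarith
  exact eventually_two_le_encard (isOpen_lt continuous_const continuous_norm) hz₀ hu0 hroot h1.ne'
    h1 hr

/-- The roots with `τ = 1` exist for `0 < |a| < 1`, and there the limit derivative has modulus
`|2 |a| - 1| < 1`. -/
theorem eventually_two_le_encard_senseReversingZeros {R : RatFunc ℂ} {z₀ : ℂ}
    (hz₀ : z₀ ∈ zeros R) (ha : 0 < ‖deriv (ratEval R) z₀‖) (ha' : ‖deriv (ratEval R) z₀‖ < 1)
    {r : ℝ} (hr : 0 < r) :
    ∀ᶠ ε in 𝓝[>] (0 : ℝ),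
      2 ≤ (senseReversingZeros (perturb R z₀ ε) ∩ Metric.ball z₀ r).encard := by
  obtain ⟨u, hu0, hroot, hn⟩ := exists_root_limit_equation (norm_pos_iff.mp ha) (τ := 1)
    (by norm_num) (by linarith)
  have h1 : ‖deriv (ratEval R) z₀ - (u ^ 2)⁻¹‖ < 1 := by
    rw [hn, abs_lt]
    constructor <;> linarith
  exact eventually_two_le_encard (isOpen_lt continuous_norm continuous_const) hz₀ hu0 hroot h1.ne
    h1 hr

/-! ### Combining the local and the global count -/

theorem exists_pos_of_eventually_nhdsGT {P : ℝ → Prop} (h : ∀ᶠ ε in 𝓝[>] (0 : ℝ), P ε) :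
    ∃ ε₀ : ℝ, 0 < ε₀ ∧ ∀ ε : ℝ, 0 < ε → ε < ε₀ → P ε := by
  obtain ⟨ε₀, h0, hsub⟩ := mem_nhdsGT_iff_exists_Ioo_subset.mp h
  exact ⟨ε₀, h0, fun ε h1 h2 => hsub ⟨h1, h2⟩⟩

theorem exists_radius_forall_mem_zeros_eq {R : RatFunc ℂ} (hreg : IsRegular R) (z₀ : ℂ) :
    ∃ r₀ : ℝ, 0 < r₀ ∧ ∀ p ∈ zeros R, dist p z₀ ≤ r₀ → p = z₀ := by
  obtain ⟨r₀, h0, hsub⟩ := Metric.nhds_basis_closedBall.eventually_iff.mp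
    (eventually_eq_of_mem_zeros hreg z₀)
  exact ⟨r₀, h0, fun p hp hd => hsub hd hp⟩

theorem eventually_sameFiniteCard_of_radius {R : RatFunc ℂ} (hreg : IsRegular R)
    (hlim : Tendsto (harm R) (cocompact ℂ) (cocompact ℂ)) {z₀ : ℂ} {r₀ r : ℝ}
    (h : ∀ p ∈ zeros R, dist p z₀ ≤ r₀ → p = z₀) (hr : 0 < r) (hr₀ : r ≤ r₀) :
    ∀ᶠ ε in 𝓝[>] (0 : ℝ), SameFiniteCard (zeros (perturb R z₀ ε) \ Metric.ball z₀ r)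
      (zeros R \ Metric.ball z₀ r) := by
  refine eventually_sameFiniteCard_zeros_diff_ball hreg hlim hr.le (fun p hp hd => ?_) ?_
  · rw [h p hp (hd.trans_le hr₀), dist_self] at hd
    exact hr.ne hd
  · filter_upwards [(Metric.isOpen_ball.eventually_mem (Metric.mem_ball_self hr)).prod_inr _]
      with x hx h using h.2 hx

end RationalHarmonic

theorem mainTheorem3 (R : RatFunc ℂ) (hdeg : 2 ≤ RationalHarmonic.ratDegree R)
    (hreg : RationalHarmonic.IsRegular R)
    (hlim : Filter.Tendsto (RationalHarmonic.harm R) (Filter.cocompact ℂ) (Filter.cocompact ℂ))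
    (z₀ : ℂ) :
    -- Case 1: `z₀` is a pole of `f`.
    (RationalHarmonic.IsPole R z₀ →
      ∃ ε₀ : ℝ, 0 < ε₀ ∧ ∀ ε : ℝ, 0 < ε → ε < ε₀ →
        RationalHarmonic.IsRegular (RationalHarmonic.perturb R z₀ ε) →
        RationalHarmonic.SameFiniteCard
          (RationalHarmonic.zeros (RationalHarmonic.perturb R z₀ ε))
          (RationalHarmonic.zeros R)) ∧
    -- Case 2: `0 < |f(z₀)| < ∞`.
    (¬ RationalHarmonic.IsPole R z₀ → RationalHarmonic.harm R z₀ ≠ 0 →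
      ∃ r₀ : ℝ, 0 < r₀ ∧ ∀ r : ℝ, 0 < r → r ≤ r₀ →
        (∀ z ∈ Metric.ball z₀ r,
          ¬ RationalHarmonic.IsPole R z ∧ RationalHarmonic.harm R z ≠ 0) ∧
        ∃ ε₀ : ℝ, 0 < ε₀ ∧ ∀ ε : ℝ, 0 < ε → ε < ε₀ →
          RationalHarmonic.IsRegular (RationalHarmonic.perturb R z₀ ε) →
          1 ≤ (RationalHarmonic.sensePreservingZeros (RationalHarmonic.perturb R z₀ ε) ∩
            Metric.ball z₀ r).encard ∧
          RationalHarmonic.SameFiniteCard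
            (RationalHarmonic.zeros (RationalHarmonic.perturb R z₀ ε) \ Metric.ball z₀ r)
            (RationalHarmonic.zeros R \ Metric.ball z₀ r)) ∧
    -- Case 3: `z₀` is a sense-preserving zero of `f`.
    (z₀ ∈ RationalHarmonic.zeros R → 1 < ‖deriv (RationalHarmonic.ratEval R) z₀‖ →
      ∃ r₀ : ℝ, 0 < r₀ ∧ ∀ r : ℝ, 0 < r → r ≤ r₀ →
        ∃ ε₀ : ℝ, 0 < ε₀ ∧ ∀ ε : ℝ, 0 < ε → ε < ε₀ →
          RationalHarmonic.IsRegular (RationalHarmonic.perturb R z₀ ε) →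
          2 ≤ (RationalHarmonic.sensePreservingZeros (RationalHarmonic.perturb R z₀ ε) ∩
            Metric.ball z₀ r).encard ∧
          RationalHarmonic.SameFiniteCard
            (RationalHarmonic.zeros (RationalHarmonic.perturb R z₀ ε) \ Metric.ball z₀ r)
            (RationalHarmonic.zeros R \ Metric.ball z₀ r)) ∧
    -- Case 4: `z₀` is a sense-reversing zero of `f` with `R'(z₀) ≠ 0`.
    (z₀ ∈ RationalHarmonic.zeros R → 0 < ‖deriv (RationalHarmonic.ratEval R) z₀‖ →
      ‖deriv (RationalHarmonic.ratEval R) z₀‖ < 1 →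
      ∃ r₀ : ℝ, 0 < r₀ ∧ ∀ r : ℝ, 0 < r → r ≤ r₀ →
        ∃ ε₀ : ℝ, 0 < ε₀ ∧ ∀ ε : ℝ, 0 < ε → ε < ε₀ →
          RationalHarmonic.IsRegular (RationalHarmonic.perturb R z₀ ε) →
          2 ≤ (RationalHarmonic.sensePreservingZeros (RationalHarmonic.perturb R z₀ ε) ∩
            Metric.ball z₀ r).encard ∧
          2 ≤ (RationalHarmonic.senseReversingZeros (RationalHarmonic.perturb R z₀ ε) ∩
            Metric.ball z₀ r).encard ∧
          RationalHarmonic.SameFiniteCard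
            (RationalHarmonic.zeros (RationalHarmonic.perturb R z₀ ε) \ Metric.ball z₀ r)
            (RationalHarmonic.zeros R \ Metric.ball z₀ r)) := by
  open RationalHarmonic in
  refine ⟨fun hpole => ?_, fun hnp h0 => ?_, fun hz ha => ?_, fun hz ha ha' => ?_⟩
  · -- With radius `0` the disk is empty, so all zeros are counted.
    have h1 := eventually_sameFiniteCard_zeros_diff_ball hreg hlim (z₀ := z₀) le_rfl
      (fun p hp hd => hp.1 (dist_eq_zero.mp hd ▸ hpole))
      (hpole.eventually_notMem_zeros_perturb_self.mono fun x hx h => hx h.1)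
    simp only [Metric.ball_zero, Set.sdiff_empty] at h1
    obtain ⟨ε₀, hε₀, h⟩ := exists_pos_of_eventually_nhdsGT h1
    exact ⟨ε₀, hε₀, fun ε h1 h2 _ => h ε h1 h2⟩
  · obtain ⟨r₁, hr₁, hiso⟩ := exists_radius_forall_mem_zeros_eq hreg z₀
    obtain ⟨r₂, hr₂, hnopole⟩ := Metric.isOpen_iff.mp (isOpen_setOf_not_isPole R) z₀ hnp
    refine ⟨min r₁ r₂, lt_min hr₁ hr₂, fun r hr hr' => ⟨fun z hz => ?_, ?_⟩⟩
    · have hz' : ¬ IsPole R z := hnopole (Metric.ball_subset_ball (hr'.trans (min_le_right _ _)) hz)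
      refine ⟨hz', fun hz0 => h0 ?_⟩
      have := hiso z ⟨hz', hz0⟩ ((Metric.mem_ball.mp hz).le.trans (hr'.trans (min_le_left _ _)))
      rwa [← this]
    · obtain ⟨ε₀, hε₀, h⟩ := exists_pos_of_eventually_nhdsGT
        ((eventually_one_le_encard_sensePreservingZeros hnp h0 hr).and
          (eventually_sameFiniteCard_of_radius hreg hlim hiso hr (hr'.trans (min_le_left _ _))))
      exact ⟨ε₀, hε₀, fun ε h1 h2 _ => h ε h1 h2⟩
  · obtain ⟨r₀, hr₀, hiso⟩ := exists_radius_forall_mem_zeros_eq hreg z₀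
    refine ⟨r₀, hr₀, fun r hr hr' => ?_⟩
    obtain ⟨ε₀, hε₀, h⟩ := exists_pos_of_eventually_nhdsGT
      ((eventually_two_le_encard_sensePreservingZeros hz
        (norm_pos_iff.mp (one_pos.trans ha)) hr).and
        (eventually_sameFiniteCard_of_radius hreg hlim hiso hr hr'))
    exact ⟨ε₀, hε₀, fun ε h1 h2 _ => h ε h1 h2⟩
  · obtain ⟨r₀, hr₀, hiso⟩ := exists_radius_forall_mem_zeros_eq hreg z₀
    refine ⟨r₀, hr₀, fun r hr hr' => ?_⟩
    obtain ⟨ε₀, hε₀, h⟩ := exists_pos_of_eventually_nhdsGT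
      ((eventually_two_le_encard_sensePreservingZeros hz (norm_pos_iff.mp ha) hr).and
        ((eventually_two_le_encard_senseReversingZeros hz ha ha' hr).and
          (eventually_sameFiniteCard_of_radius hreg hlim hiso hr hr')))
    exact ⟨ε₀, hε₀, fun ε h1 h2 _ => h ε h1 h2⟩
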